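/- For $n\ge 0$ let $$a_n=\binom{2n}{n}\binom{4n}{2n}\sum_{k=0}^{n}16^{\,n-k}\binom{2k}{k}^{3}\binom{2n-2k}{n-k}, \qquad b_n=\sum_{j=0}^{n}(-1)^j\binom{n}{j}a_j .$$ Then both of the following series converge (absolutely), with the stated sums: $$\sum_{n=0}^{\infty}(-1)^n b_n\,(3276800n^2-1818624n-545735)\,\frac{1}{6399^{n}} =\frac{3^{10}\,79^{3}\sqrt5}{2^{7}\,5^{3}\,\pi^{2}},$$ $$\sum_{n=0}^{\infty}(-1)^n b_n\,(76354828515625n^2+16569725866875n+1169782053458)\,\frac{1}{1050624^{n}} =\frac{2^{33}\,3^{7}\,19^{3}\sqrt{41}}{41^{3}\,\pi^{2}}.$$ -/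

import Mathlib

/-- The sequence `a_n = C(2n,n) C(4n,2n) ∑_{k=0}^n 16^(n-k) C(2k,k)^3 C(2n-2k,n-k)`
(all natural subtractions below have `k ≤ n`). -/
def zudilinA (n : ℕ) : ℤ :=
  ((2 * n).choose n : ℤ) * ((4 * n).choose (2 * n) : ℤ) *
    ∑ k ∈ Finset.range (n + 1),
      (16 : ℤ) ^ (n - k) * ((2 * k).choose k : ℤ) ^ 3 * ((2 * n - 2 * k).choose (n - k) : ℤ)

/-- The binomial transform `b_n = ∑_{j=0}^n (-1)^j C(n,j) a_j` of a sequence `a`. -/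
def binomialTransform (a : ℕ → ℤ) (n : ℕ) : ℤ :=
  ∑ j ∈ Finset.range (n + 1), (-1 : ℤ) ^ j * (n.choose j : ℤ) * a j

/-- The binomial transform of the sequence `zudilinA`. -/
def zudilinB (n : ℕ) : ℤ := binomialTransform zudilinA n

/-! Write h_n = (1/2)_n / n!. The source of 1/π² is a pair of series of Guillera, ∑ h_n⁵ xⁿ ·
(quadratic in n) at x = -1/4 and at x = -1/1024. Both come from one WZ pair (`wz_pair`): summing
along k = 0 gives the first, summing along the diagonal gives the second, and Wallis' product
evaluates their common limit 8/π².

Two changes of variable lead from h_n⁵ to b_n. Put U(x) = ∑ h_n⁵ xⁿ, A(w) = ∑ a_n (w/1024)ⁿ and B(z)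
= ∑ b_n zⁿ. Then U(x) = (1-x)^(-1/2) A(-x/(1-x)²) (`eulerSeries_halfRatio_eq`) and B(z) = (1-z)⁻¹
A(-1024z/(1-z)) (`eulerSeries_zudilinB_eq`). The first rests on a finite expansion of h_N⁵
(`halfRatio_pow_five`), obtained from two uses of Saalschütz's summation.

The point x = -1/4 matches w = 4/25 and z = -1/6399; x = -1/1024 matches w = 1024/1050625 and z =
-1/1050624. Applying the Euler operator up to twice turns both Guillera's sum and the target series
into linear forms in the same three values of A, θA, θ²A at w, and these forms are proportional. -/

open Finset Filter Topology

/-! ### Normalized central binomials and Wallis' product. -/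

/-- The normalized central binomial coefficient `C(2n,n) / 4^n = (1/2)_n / n!`. -/
noncomputable def halfRatio (n : ℕ) : ℝ := (n.centralBinom : ℝ) / 4 ^ n

theorem halfRatio_zero : halfRatio 0 = 1 := by simp [halfRatio]

theorem halfRatio_pos (n : ℕ) : 0 < halfRatio n := by
  have := n.centralBinom_pos
  unfold halfRatio
  positivity

theorem halfRatio_succ (n : ℕ) :
    halfRatio (n + 1) = halfRatio n * ((2 * n + 1) / (2 * (n + 1))) := by
  have h : ((n : ℝ) + 1) * ((n + 1).centralBinom : ℝ) = 2 * (2 * n + 1) * (n.centralBinom : ℝ) := by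
    exact_mod_cast n.succ_mul_centralBinom_succ
  unfold halfRatio
  rw [pow_succ]
  field_simp
  linear_combination 2 * h

theorem halfRatio_le_one (n : ℕ) : halfRatio n ≤ 1 := by
  induction n with
  | zero => simp [halfRatio_zero]
  | succ n ih =>
    rw [halfRatio_succ]
    have h : ((2 * n + 1) / (2 * (n + 1)) : ℝ) ≤ 1 := by
      rw [div_le_one (by positivity)]; linarith
    exact mul_le_one₀ ih (by positivity) h

theorem centralBinom_eq_halfRatio (n : ℕ) : (n.centralBinom : ℝ) = 4 ^ n * halfRatio n := by
  unfold halfRatio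
  field_simp

theorem halfRatio_sq_eq_inv_wallis (n : ℕ) :
    halfRatio n ^ 2 * (2 * n + 1) * Real.Wallis.W n = 1 := by
  induction n with
  | zero => simp [halfRatio_zero, Real.Wallis.W]
  | succ n ih =>
    refine Eq.trans ?_ ih
    rw [halfRatio_succ, Real.Wallis.W_succ]
    push_cast
    field_simp
    ring

theorem tendsto_halfRatio_sq_mul : Tendsto (fun n : ℕ => halfRatio n ^ 2 * (2 * n + 1)) atTop
    (𝓝 (2 / Real.pi)) := by
  have h := Real.Wallis.tendsto_W_nhds_pi_div_two.inv₀ (by positivity)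
  rw [inv_div] at h
  refine h.congr fun n => ?_
  have h1 := halfRatio_sq_eq_inv_wallis n
  have h2 := Real.Wallis.W_pos n
  field_simp
  linarith

/-! ### The WZ pair and its finite summation identities. -/

/-- The common factor of the Wilf–Zeilberger pair `(wzF, wzG)`. -/
noncomputable def wzB (n k : ℕ) : ℝ :=
  (-1 / 4) ^ n * halfRatio n ^ 5 * halfRatio k ^ 4 / ((n + k).choose n : ℝ) ^ 4

noncomputable def wzG (n k : ℕ) : ℝ :=
  wzB n k * (20 * n ^ 2 + 8 * n + 1 + 24 * k * n + 8 * k ^ 2 + 4 * k)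

noncomputable def wzF (n k : ℕ) : ℝ := wzB n k * (8 * n * (2 * n + 4 * k + 1))

theorem choose_add_pos (n k : ℕ) : (0 : ℝ) < (n + k).choose n := by
  exact_mod_cast Nat.choose_pos (Nat.le_add_right n k)

theorem wzB_succ_left (n k : ℕ) : wzB (n + 1) k =
    wzB n k * (-(1 / 4) * (n + 1 / 2) ^ 5 / ((n + 1) * (n + k + 1) ^ 4)) := by
  have h : ((n + 1 + k).choose (n + 1) : ℝ) = (n + k).choose n * ((n + k + 1) / (n + 1)) := by
    have := Nat.add_one_mul_choose_eq (n + k) n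
    rw [show n + k + 1 = n + 1 + k by ring] at this
    have h' : ((n : ℝ) + 1 + k) * ((n + k).choose n) = ((n + 1 + k).choose (n + 1)) * (n + 1) := by
      exact_mod_cast this
    field_simp
    linear_combination -h'
  have := choose_add_pos n k
  unfold wzB
  rw [h, halfRatio_succ, pow_succ]
  field_simp

theorem wzB_succ_right (n k : ℕ) : wzB n (k + 1) =
    wzB n k * ((k + 1 / 2) ^ 4 / (n + k + 1) ^ 4) := by
  have h : ((n + (k + 1)).choose n : ℝ) = (n + k).choose n * ((n + k + 1) / (k + 1)) := by
    have := Nat.choose_mul_succ_eq (n + k) n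
    rw [show n + k + 1 - n = k + 1 by omega] at this
    have h' : ((n + k).choose n : ℝ) * (n + k + 1) = ((n + (k + 1)).choose n) * (k + 1) := by
      exact_mod_cast this
    field_simp
    linear_combination -h'
  have := choose_add_pos n k
  unfold wzB
  rw [h, halfRatio_succ]
  field_simp

/-- After division by `wzB n k` this is an identity of rational functions in n and k. -/
theorem wz_pair (n k : ℕ) : wzG n (k + 1) - wzG n k = wzF (n + 1) k - wzF n k := by
  unfold wzG wzF
  rw [wzB_succ_left, wzB_succ_right]
  push_cast
  field_simp
  ring

/-- On the diagonal the binomial in `wzB` is 4ⁿ h_n: its fourth power cancels `halfRatio k ^ 4` and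
turns -1/4 into -1/1024. -/
theorem wz_diagonal (n : ℕ) : wzG n n + wzF (n + 1) n =
    (-1 / 1024) ^ n * halfRatio n ^ 5 * (820 * n ^ 2 + 180 * n + 13) / 16 := by
  have hB : wzB n n = (-1 / 1024) ^ n * halfRatio n ^ 5 := by
    have h : ((n + n).choose n : ℝ) = 4 ^ n * halfRatio n := by
      rw [← centralBinom_eq_halfRatio, Nat.centralBinom, two_mul]
    have := halfRatio_pos n
    unfold wzB
    rw [h, show (-1 / 1024 : ℝ) = -1 / 4 / 4 ^ 4 by norm_num, div_pow (-1 / 4 : ℝ), mul_pow,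
      ← pow_mul, ← pow_mul, mul_comm 4 n]
    field_simp
  unfold wzG wzF
  rw [wzB_succ_left, hB]
  push_cast
  field_simp
  ring

theorem wzF_zero (k : ℕ) : wzF 0 k = 0 := by simp [wzF]

theorem sum_wzG_sub (n k : ℕ) :
    ∑ m ∈ range n, wzG m k = ∑ m ∈ range n, wzG m 0 + ∑ j ∈ range k, wzF n j := by
  induction k with
  | zero => simp
  | succ k ih =>
    have h : ∑ m ∈ range n, (wzG m (k + 1) - wzG m k) = wzF n k := by
      simp_rw [wz_pair]
      rw [sum_range_sub (fun m => wzF m k), wzF_zero, sub_zero]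
    rw [sum_sub_distrib] at h
    rw [sum_range_succ, ← add_assoc, ← ih]
    linarith

/-- The WZ relation makes (G, F) a closed discrete form, so the staircase along the diagonal can be
exchanged for a straight path at height n; the edge at first index 0 costs nothing because F
vanishes there. -/
theorem sum_wz_diagonal (n : ℕ) :
    ∑ m ∈ range n, (wzG m m + wzF (m + 1) m) = ∑ m ∈ range n, wzG m n := by
  induction n with
  | zero => simp
  | succ n ih =>
    rw [sum_range_succ, ih, sum_wzG_sub n n, sum_wzG_sub (n + 1) (n + 1), sum_range_succ,
      sum_range_succ _ n]
    have := sum_wzG_sub n n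
    have h2 := sum_wzG_sub (n + 1) n
    rw [sum_range_succ, sum_range_succ] at h2
    linarith

/-! ### Bounds and limits for the WZ sums. -/

theorem abs_wzB_le (n k : ℕ) : |wzB n k| ≤ (1 / 4) ^ n * halfRatio k ^ 4 := by
  have h := choose_add_pos n k
  have h1 : (1 : ℝ) ≤ ((n + k).choose n : ℝ) := by
    exact_mod_cast Nat.choose_pos (Nat.le_add_right n k)
  have hn := halfRatio_pos n
  have hk := halfRatio_pos k
  unfold wzB
  rw [abs_div, abs_mul, abs_mul, abs_pow, abs_of_pos (pow_pos hn 5), abs_of_pos (pow_pos hk 4),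
    abs_of_pos (pow_pos h 4), show |(-1 / 4 : ℝ)| = 1 / 4 by norm_num [abs_div]]
  apply (div_le_self (by positivity) (one_le_pow₀ h1)).trans
  gcongr
  exact mul_le_of_le_one_right (by positivity) (pow_le_one₀ hn.le (halfRatio_le_one n))

theorem halfRatio_sq_mul_le_one (n : ℕ) : halfRatio n ^ 2 * (2 * n + 1) ≤ 1 := by
  induction n with
  | zero => simp [halfRatio_zero]
  | succ n ih =>
    have h : halfRatio (n + 1) ^ 2 * (2 * ((n + 1 : ℕ) : ℝ) + 1) =
        (halfRatio n ^ 2 * (2 * n + 1)) * ((2 * n + 1) * (2 * n + 3) / (2 * n + 2) ^ 2) := by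
      rw [halfRatio_succ]
      push_cast
      field_simp
      ring
    rw [h]
    refine mul_le_one₀ ih (by positivity) ?_
    rw [div_le_one (by positivity)]
    linarith

/-- Uniformity in k is the point: the bound is the dominating series in `tendsto_sum_wzG`. -/
theorem abs_wzG_le (n k : ℕ) : |wzG n k| ≤ 20 * (n + 1) ^ 2 * (1 / 4) ^ n := by
  have h1 := abs_wzB_le n k
  have h2 : halfRatio k ^ 4 * (2 * k + 1) ^ 2 ≤ 1 := by
    have := pow_le_one₀ (n := 2) (by have := halfRatio_pos k; positivity)
      (halfRatio_sq_mul_le_one k)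
    linarith
  have h3 : (20 * n ^ 2 + 8 * n + 1 + 24 * k * n + 8 * k ^ 2 + 4 * k : ℝ) ≤
      20 * (n + 1) ^ 2 * (2 * k + 1) ^ 2 := by
    have : (0 : ℝ) ≤ 20 * (n + 1) ^ 2 * (2 * k + 1) ^ 2 -
        (20 * n ^ 2 + 8 * n + 1 + 24 * k * n + 8 * k ^ 2 + 4 * k) := by
      ring_nf
      positivity
    linarith
  unfold wzG
  rw [abs_mul, abs_of_nonneg (by positivity :
    (0 : ℝ) ≤ 20 * n ^ 2 + 8 * n + 1 + 24 * k * n + 8 * k ^ 2 + 4 * k)]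
  calc _ ≤ (1 / 4) ^ n * halfRatio k ^ 4 * (20 * (n + 1) ^ 2 * (2 * k + 1) ^ 2) := by gcongr
    _ = 20 * (n + 1) ^ 2 * (1 / 4) ^ n * (halfRatio k ^ 4 * (2 * k + 1) ^ 2) := by ring
    _ ≤ _ := mul_le_of_le_one_right (by positivity) h2

/-- For positive first index the binomial in the denominator is at least k + 1, which forces decay
in k. -/
theorem abs_wzG_succ_le (n k : ℕ) :
    |wzG (n + 1) k| ≤ 24 * (n + 2) ^ 2 * (1 / (k + 1)) := by
  have hc : (k + 1 : ℝ) ≤ ((n + 1 + k).choose (n + 1) : ℝ) := by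
    rw [Nat.choose_symm_add]
    have := Nat.choose_le_choose k (show k + 1 ≤ n + 1 + k by omega)
    rw [Nat.choose_succ_self_right] at this
    exact_mod_cast this
  have h2 : halfRatio k ^ 4 * (2 * k + 1) ^ 2 ≤ 1 := by
    have := pow_le_one₀ (n := 2) (by have := halfRatio_pos k; positivity)
      (halfRatio_sq_mul_le_one k)
    linarith
  have hk1 : (1 : ℝ) ≤ k + 1 := by linarith [k.cast_nonneg (α := ℝ)]
  have hB : |wzB (n + 1) k| ≤ halfRatio k ^ 4 * (1 / (k + 1)) := by
    have hp := choose_add_pos (n + 1) k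
    have hn := halfRatio_pos (n + 1)
    have hk := halfRatio_pos k
    have h4 : (k + 1 : ℝ) ≤ ((n + 1 + k).choose (n + 1) : ℝ) ^ 4 :=
      hc.trans (le_self_pow₀ (hk1.trans hc) (by norm_num))
    unfold wzB
    rw [abs_div, abs_mul, abs_mul, abs_pow, abs_of_pos (pow_pos hn 5), abs_of_pos (pow_pos hk 4),
      abs_of_pos (pow_pos hp 4), show |(-1 / 4 : ℝ)| = 1 / 4 by norm_num [abs_div], ← mul_one_div]
    have ha : (1 / 4 : ℝ) ^ (n + 1) * halfRatio (n + 1) ^ 5 ≤ 1 :=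
      mul_le_one₀ (pow_le_one₀ (by norm_num) (by norm_num)) (by positivity)
        (pow_le_one₀ hn.le (halfRatio_le_one _))
    gcongr
    exact mul_le_of_le_one_left (by positivity) ha
  have h3 : (20 * ((n + 1 : ℕ) : ℝ) ^ 2 + 8 * (n + 1 : ℕ) + 1 + 24 * k * (n + 1 : ℕ) + 8 * k ^ 2
      + 4 * k : ℝ) ≤ 24 * (n + 2) ^ 2 * (2 * k + 1) ^ 2 := by
    have : (0 : ℝ) ≤ 24 * (n + 2) ^ 2 * (2 * k + 1) ^ 2 -
        (20 * ((n + 1 : ℕ) : ℝ) ^ 2 + 8 * (n + 1 : ℕ) + 1 + 24 * k * (n + 1 : ℕ) + 8 * k ^ 2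
          + 4 * k : ℝ) := by
      push_cast
      ring_nf
      positivity
    linarith
  unfold wzG
  rw [abs_mul, abs_of_nonneg (by positivity : (0 : ℝ) ≤ 20 * ((n + 1 : ℕ) : ℝ) ^ 2 +
    8 * (n + 1 : ℕ) + 1 + 24 * k * (n + 1 : ℕ) + 8 * k ^ 2 + 4 * k)]
  calc _ ≤ halfRatio k ^ 4 * (1 / (k + 1)) * (24 * (n + 2) ^ 2 * (2 * k + 1) ^ 2) := by gcongr
    _ = 24 * (n + 2) ^ 2 * (1 / (k + 1)) * (halfRatio k ^ 4 * (2 * k + 1) ^ 2) := by ring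
    _ ≤ _ := mul_le_of_le_one_right (by positivity) h2

theorem tendsto_wzG_zero : Tendsto (wzG 0) atTop (𝓝 (8 / Real.pi ^ 2)) := by
  have he : Tendsto (fun k : ℕ => 1 / (2 * (k : ℝ) + 1)) atTop (𝓝 0) := by
    refine tendsto_const_nhds.div_atTop ?_
    exact tendsto_atTop_add_const_right _ _
      (tendsto_natCast_atTop_atTop.const_mul_atTop two_pos)
  -- With e = 1/(2k+1), (8k² + 4k + 1)/(2k+1)² = 2 - 2e + e².
  have h := (tendsto_halfRatio_sq_mul.pow 2).mul
    (((he.const_mul 2).const_sub 2).add (he.pow 2))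
  have hl : (2 / Real.pi) ^ 2 * (2 - 2 * 0 + 0 ^ 2) = 8 / Real.pi ^ 2 := by
    rw [div_pow]; ring
  rw [hl] at h
  refine h.congr fun k => ?_
  simp only [wzG, wzB, halfRatio_zero, Nat.zero_add, Nat.choose_zero_right]
  push_cast
  field_simp
  ring

theorem tendsto_wzG_succ (n : ℕ) : Tendsto (wzG (n + 1)) atTop (𝓝 0) := by
  have h := (tendsto_one_div_add_atTop_nhds_zero_nat (𝕜 := ℝ)).const_mul (24 * ((n : ℝ) + 2) ^ 2)
  rw [mul_zero] at h
  exact squeeze_zero_norm (abs_wzG_succ_le n) h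

theorem summable_wzG_bound : Summable fun n : ℕ => 20 * ((n : ℝ) + 1) ^ 2 * (1 / 4) ^ n := by
  have h (k : ℕ) := summable_pow_mul_geometric_of_norm_lt_one (R := ℝ) k
    (r := 1 / 4) (by norm_num)
  convert! (((h 2).mul_left 20).add ((h 1).mul_left 40)).add ((h 0).mul_left 20) using 1
  funext n
  ring

/-- Dominated convergence: only the term m = 0 survives in the limit. -/
theorem tendsto_sum_wzG :
    Tendsto (fun n => ∑ m ∈ range n, wzG m n) atTop (𝓝 (8 / Real.pi ^ 2)) := by
  have h := tendsto_tsum_of_dominated_convergence (𝓕 := atTop)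
    (f := fun n m => if m ∈ range n then wzG m n else 0)
    (g := fun m => if m = 0 then 8 / Real.pi ^ 2 else 0) summable_wzG_bound
    (fun m => by
      have hev : ∀ᶠ n in atTop, wzG m n = if m ∈ range n then wzG m n else 0 := by
        filter_upwards [eventually_gt_atTop m] with n hn
        rw [if_pos (mem_range.mpr hn)]
      refine Tendsto.congr' hev ?_
      cases m with
      | zero => simpa using tendsto_wzG_zero
      | succ m => simpa using tendsto_wzG_succ m)
    (Eventually.of_forall fun n m => by
      split_ifs
      · exact abs_wzG_le m n
      · rw [norm_zero]; positivity)
  rw [tsum_ite_eq] at h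
  refine h.congr fun n => ?_
  rw [tsum_eq_sum (s := range n) fun m hm => if_neg hm]
  exact sum_congr rfl fun m hm => if_pos hm

theorem tendsto_sum_wzF : Tendsto (fun n => ∑ j ∈ range n, wzF n j) atTop (𝓝 0) := by
  have h := (tendsto_pow_const_mul_const_pow_of_abs_lt_one 3 (r := 1 / 4)
    (by norm_num [abs_div])).const_mul (56 : ℝ)
  rw [mul_zero] at h
  refine squeeze_zero_norm (fun n => ?_) h
  have hF (j : ℕ) (hj : j ∈ range n) : ‖wzF n j‖ ≤ 56 * n ^ 2 * (1 / 4) ^ n := by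
    have hj' : (j : ℝ) + 1 ≤ n := by exact_mod_cast mem_range.mp hj
    have hp := halfRatio_pos j
    have h1 : |wzB n j| ≤ (1 / 4) ^ n := (abs_wzB_le n j).trans
      (mul_le_of_le_one_right (by positivity) (pow_le_one₀ hp.le (halfRatio_le_one j)))
    have h2 : (8 * n * (2 * n + 4 * j + 1) : ℝ) ≤ 56 * n ^ 2 := by nlinarith
    unfold wzF
    rw [Real.norm_eq_abs, abs_mul,
      abs_of_nonneg (by positivity : (0 : ℝ) ≤ 8 * n * (2 * n + 4 * j + 1))]
    calc _ ≤ (1 / 4 : ℝ) ^ n * (56 * n ^ 2) := by gcongr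
      _ = _ := by ring
  refine (norm_sum_le_of_le _ hF).trans (le_of_eq ?_)
  rw [sum_const, card_range, nsmul_eq_mul]
  ring

theorem tendsto_sum_wzG_zero :
    Tendsto (fun n => ∑ m ∈ range n, wzG m 0) atTop (𝓝 (8 / Real.pi ^ 2)) := by
  have h := tendsto_sum_wzG.sub tendsto_sum_wzF
  rw [sub_zero] at h
  refine h.congr fun n => ?_
  rw [sum_wzG_sub n n]
  ring

theorem tendsto_sum_wz_diagonal :
    Tendsto (fun n => ∑ m ∈ range n, (wzG m m + wzF (m + 1) m)) atTop (𝓝 (8 / Real.pi ^ 2)) :=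
  tendsto_sum_wzG.congr fun n => (sum_wz_diagonal n).symm

/-! ### Euler series and Guillera's two evaluations. -/

/-- The power series `∑ nⁱ c_n xⁿ`. -/
noncomputable def eulerSeries (c : ℕ → ℝ) (i : ℕ) (x : ℝ) : ℝ := ∑' n : ℕ, (n : ℝ) ^ i * c n * x ^ n

/-- Polynomially weighted geometric majorant of ratio `r` for the coefficients `c`. -/
def GeomBound (c : ℕ → ℝ) (r : ℝ) : Prop := ∀ n : ℕ, |c n| ≤ (n + 1) * r ^ n

theorem GeomBound.summable {c : ℕ → ℝ} {r : ℝ} (hc : GeomBound c r) (hr : 0 < r) (i : ℕ) {x : ℝ}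
    (hx : |x| < 1 / r) : Summable fun n : ℕ => (n : ℝ) ^ i * c n * x ^ n := by
  have hrx : ‖r * |x|‖ < 1 := by
    rw [Real.norm_eq_abs, abs_mul, abs_abs, abs_of_pos hr]
    calc r * |x| < r * (1 / r) := by gcongr
      _ = 1 := by field_simp
  have h (k : ℕ) := summable_pow_mul_geometric_of_norm_lt_one (R := ℝ) k hrx
  refine Summable.of_norm_bounded ((h (i + 1)).add (h i)) fun n => ?_
  rw [norm_mul, norm_mul, norm_pow, norm_pow, Real.norm_natCast, Real.norm_eq_abs, Real.norm_eq_abs]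
  calc _ ≤ (n : ℝ) ^ i * ((n + 1) * r ^ n) * |x| ^ n := by gcongr; exact hc n
    _ = _ := by rw [mul_pow]; ring

theorem geomBound_halfRatio_pow : GeomBound (fun n => halfRatio n ^ 5) 1 := fun n => by
  have h := halfRatio_pos n
  rw [abs_of_pos (pow_pos h 5), one_pow, mul_one]
  have := pow_le_one₀ (n := 5) h.le (halfRatio_le_one n)
  linarith [n.cast_nonneg (α := ℝ)]

theorem GeomBound.hasSum_quadratic {c : ℕ → ℝ} {r : ℝ} (hc : GeomBound c r) (hr : 0 < r) {x : ℝ}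
    (hx : |x| < 1 / r) (p q s : ℝ) :
    HasSum (fun n : ℕ => c n * x ^ n * (p * n ^ 2 + q * n + s))
      (p * eulerSeries c 2 x + q * eulerSeries c 1 x + s * eulerSeries c 0 x) := by
  have h (i : ℕ) := (hc.summable hr i hx).hasSum
  convert! (((h 2).mul_left p).add ((h 1).mul_left q)).add ((h 0).mul_left s) using 1
  funext n
  ring

theorem guillera_quarter :
    20 * eulerSeries (fun n => halfRatio n ^ 5) 2 (-1 / 4) +
      8 * eulerSeries (fun n => halfRatio n ^ 5) 1 (-1 / 4) +
      1 * eulerSeries (fun n => halfRatio n ^ 5) 0 (-1 / 4) = 8 / Real.pi ^ 2 := by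
  have h := (geomBound_halfRatio_pow.hasSum_quadratic one_pos (x := -1 / 4)
    (by norm_num [abs_div]) 20 8 1).tendsto_sum_nat
  refine tendsto_nhds_unique h (tendsto_sum_wzG_zero.congr fun n => sum_congr rfl fun m _ => ?_)
  simp only [wzG, wzB, halfRatio_zero, Nat.add_zero, Nat.choose_self]
  push_cast
  ring

theorem guillera_inv_1024 :
    820 * eulerSeries (fun n => halfRatio n ^ 5) 2 (-1 / 1024) +
      180 * eulerSeries (fun n => halfRatio n ^ 5) 1 (-1 / 1024) +
      13 * eulerSeries (fun n => halfRatio n ^ 5) 0 (-1 / 1024) = 128 / Real.pi ^ 2 := by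
  have h := (geomBound_halfRatio_pow.hasSum_quadratic one_pos (x := -1 / 1024)
    (by norm_num [abs_div]) 820 180 13).tendsto_sum_nat
  have h2 := tendsto_sum_wz_diagonal.const_mul 16
  rw [show 16 * (8 / Real.pi ^ 2) = 128 / Real.pi ^ 2 by ring] at h2
  refine tendsto_nhds_unique h (h2.congr fun n => ?_)
  rw [mul_sum]
  refine sum_congr rfl fun m _ => ?_
  rw [wz_diagonal]
  ring

/-! ### Saalschütz summation and the expansion of h_N⁵. -/

/-- `(1/2)_{N+n} / (n!² (N-n)!)`. -/
noncomputable def saalCoeff (N n : ℕ) : ℝ :=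
  halfRatio (N + n) * ((N + n).choose n : ℝ) * (N.choose n : ℝ)

theorem saalCoeff_succ_right (N n : ℕ) :
    saalCoeff N (n + 1) * (2 * (n + 1) ^ 2) = saalCoeff N n * ((2 * N + 2 * n + 1) * (N - n)) := by
  have h1 : ((N + n + 1).choose (n + 1) : ℝ) = (N + n).choose n * ((N + n + 1) / (n + 1)) := by
    have h := Nat.add_one_mul_choose_eq (N + n) n
    have h' : ((N : ℝ) + n + 1) * ((N + n).choose n) = ((N + n + 1).choose (n + 1)) * (n + 1) := by
      exact_mod_cast h
    field_simp
    linear_combination -h'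
  have h2 : (N.choose (n + 1) : ℝ) = N.choose n * ((N - n) / (n + 1)) := by
    have h := Nat.choose_succ_right_eq N n
    rcases le_or_gt n N with hn | hn
    · have h' : (N.choose (n + 1) : ℝ) * (n + 1) = N.choose n * (N - n) := by
        rw [← Nat.cast_sub hn]
        exact_mod_cast h
      field_simp
      linear_combination h'
    · rw [Nat.choose_eq_zero_of_lt hn, Nat.choose_eq_zero_of_lt (by omega)]
      simp
  unfold saalCoeff
  rw [← add_assoc, halfRatio_succ, h1, h2]
  push_cast
  field_simp

/-- The terms of the Saalschützian sum `∑_m (-1)^{k+m} (1/2)_m / m! · saalCoeff N (k+m)`. -/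
noncomputable def saalTerm (N k m : ℕ) : ℝ := (-1) ^ (k + m) * halfRatio m * saalCoeff N (k + m)

/-- A contiguous relation in k between truncated sums; keeping the cutoff L and its boundary term
makes it provable by induction on L. -/
theorem saalTerm_telescope (N k L : ℕ) :
    (2 * k + 1) ^ 2 * ∑ m ∈ range L, saalTerm N (k + 1) m +
      2 * (2 * N + 2 * k + 1) * (N - k) * ∑ m ∈ range (L + 1), saalTerm N k m =
    4 * (-1) ^ (k + L) * (k + L + 1) ^ 2 * halfRatio L * saalCoeff N (k + L + 1) := by
  induction L with
  | zero =>
    have h := saalCoeff_succ_right N k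
    simp only [range_zero, sum_empty, range_one, zero_add, sum_singleton, saalTerm, halfRatio_zero,
      Nat.cast_zero, add_zero]
    linear_combination (-2) * (-1) ^ k * h
  | succ L ih =>
    have h := saalCoeff_succ_right N (k + L + 1)
    rw [sum_range_succ, sum_range_succ _ (L + 1), mul_add, mul_add]
    have e : saalTerm N (k + 1) L = (-1) ^ (k + L + 1) * halfRatio L * saalCoeff N (k + L + 1) := by
      unfold saalTerm
      rw [show k + 1 + L = k + L + 1 by ring]
    have e' : saalTerm N k (L + 1) =
        (-1) ^ (k + L + 1) * (halfRatio L * ((2 * L + 1) / (2 * (L + 1)))) *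
          saalCoeff N (k + L + 1) := by
      unfold saalTerm
      rw [← halfRatio_succ, ← add_assoc]
    rw [e, e', halfRatio_succ, ← add_assoc k L 1]
    push_cast at h ⊢
    have h' : saalCoeff N (k + L + 1 + 1) = saalCoeff N (k + L + 1) *
        ((2 * N + 2 * (k + L + 1) + 1) * (N - (k + L + 1))) / (2 * (k + L + 1 + 1) ^ 2) := by
      rw [← h]
      field_simp
    rw [h', eq_sub_of_add_eq ih, pow_succ (-1 : ℝ) (k + L)]
    have : (k : ℝ) + (L + 1) + 1 = k + L + 1 + 1 := by ring
    rw [this]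
    field_simp
    ring

theorem saalCoeff_eq_zero_of_lt {N n : ℕ} (h : N < n) : saalCoeff N n = 0 := by
  simp [saalCoeff, Nat.choose_eq_zero_of_lt h]

/-- This is Pfaff–Saalschütz for a balanced 3F2 at 1, proved by descending induction on k from k =
N. -/
theorem sum_saalTerm (N M k : ℕ) (h : k + M = N) :
    ∑ m ∈ range (M + 1), saalTerm N k m =
      (-1) ^ k * halfRatio N ^ 2 * saalCoeff N k / halfRatio k ^ 2 := by
  induction M generalizing k with
  | zero =>
    obtain rfl : k = N := by omega
    have := halfRatio_pos k
    simp only [saalTerm, zero_add, range_one, sum_singleton, add_zero, halfRatio_zero]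
    field_simp
  | succ M ih =>
    -- At this cutoff the boundary term carries `saalCoeff N (N + 1)`, which is zero.
    have hs := saalTerm_telescope N k (M + 1)
    rw [ih (k + 1) (by omega), saalCoeff_eq_zero_of_lt (by omega : N < k + (M + 1) + 1),
      halfRatio_succ] at hs
    have h1 := saalCoeff_succ_right N k
    have hk := halfRatio_pos k
    have hN : (N : ℝ) - k = M + 1 := by
      rw [← h]; push_cast; ring
    rw [hN] at h1 hs
    have h1' : saalCoeff N (k + 1) = saalCoeff N k * ((2 * N + 2 * k + 1) * (M + 1)) /
        (2 * (k + 1) ^ 2) := by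
      rw [← h1]
      field_simp
    rw [h1', pow_succ] at hs
    field_simp at hs
    have hz := (mul_eq_zero.mp (hs.trans (mul_zero _))).resolve_left (by positivity)
    rw [eq_div_iff (by positivity)]
    linear_combination hz

/-- The convolution of the cubes `((1/2)_k / k!)³` with `(1/2)_k / k!`. -/
noncomputable def cubeConv (n : ℕ) : ℝ :=
  ∑ k ∈ range (n + 1), halfRatio k ^ 3 * halfRatio (n - k)

/-- After exchanging the sums, the inner one is Saalschütz at k, which leaves `saalTerm N 0 k`; the
outer one is Saalschütz again at 0. -/
theorem halfRatio_pow_five (N : ℕ) :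
    halfRatio N ^ 5 = ∑ n ∈ range (N + 1), (-1) ^ n * cubeConv n * saalCoeff N n := by
  have h0 := sum_saalTerm N N 0 (by omega)
  simp only [pow_zero, one_mul, halfRatio_zero, one_pow, div_one] at h0
  have hs : saalCoeff N 0 = halfRatio N := by simp [saalCoeff]
  rw [hs] at h0
  have hk (k : ℕ) (hk : k ∈ range (N + 1)) :
      ∑ n ∈ Ico k (N + 1), halfRatio k ^ 3 * halfRatio (n - k) * ((-1) ^ n * saalCoeff N n) =
        halfRatio N ^ 2 * saalTerm N 0 k := by
    have hkN : k ≤ N := by simpa [Nat.lt_succ_iff] using hk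
    have hp := halfRatio_pos k
    have h := sum_saalTerm N (N - k) k (by omega)
    rw [sum_Ico_eq_sum_range, show N + 1 - k = N - k + 1 by omega]
    calc _ = halfRatio k ^ 3 * ∑ m ∈ range (N - k + 1), saalTerm N k m := by
          rw [mul_sum]
          refine sum_congr rfl fun m _ => ?_
          rw [Nat.add_sub_cancel_left]
          unfold saalTerm
          ring
      _ = _ := by
          rw [h]
          unfold saalTerm
          rw [zero_add]
          field_simp
  symm
  calc _ = ∑ n ∈ range (N + 1), ∑ k ∈ range (n + 1),
        halfRatio k ^ 3 * halfRatio (n - k) * ((-1) ^ n * saalCoeff N n) := by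
        refine sum_congr rfl fun n _ => ?_
        rw [← sum_mul]
        unfold cubeConv
        ring
    _ = ∑ k ∈ range (N + 1), ∑ n ∈ Ico k (N + 1),
        halfRatio k ^ 3 * halfRatio (n - k) * ((-1) ^ n * saalCoeff N n) := by
        refine sum_comm' fun n k => ?_
        simp only [mem_range, mem_Ico]
        omega
    _ = halfRatio N ^ 2 * ∑ k ∈ range (N + 1), saalTerm N 0 k := by
        rw [mul_sum]
        exact sum_congr rfl hk
    _ = _ := by rw [h0]; ring

/-! ### The quadratic transformation for the generating function of a_n. -/

/-- The rescaled sequence `zudilinA n / 1024 ^ n`. -/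
noncomputable def scaledA (n : ℕ) : ℝ := (n.centralBinom : ℝ) * halfRatio (2 * n) * cubeConv n

theorem zudilinA_eq (n : ℕ) : (zudilinA n : ℝ) = 1024 ^ n * scaledA n := by
  have h2 : ((4 * n).choose (2 * n) : ℝ) = 16 ^ n * halfRatio (2 * n) := by
    rw [show 4 * n = 2 * (2 * n) by ring, ← Nat.centralBinom, centralBinom_eq_halfRatio, pow_mul]
    norm_num
  have h3 : ∑ k ∈ range (n + 1), (16 : ℝ) ^ (n - k) * ((2 * k).choose k : ℝ) ^ 3 *
      ((2 * n - 2 * k).choose (n - k) : ℝ) = 64 ^ n * cubeConv n := by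
    unfold cubeConv
    rw [mul_sum]
    refine sum_congr rfl fun k hk => ?_
    have hkn : k ≤ n := by simpa [Nat.lt_succ_iff] using hk
    obtain ⟨m, rfl⟩ := Nat.exists_eq_add_of_le hkn
    rw [show 2 * (k + m) - 2 * k = 2 * m by omega, Nat.add_sub_cancel_left, ← Nat.centralBinom,
      ← Nat.centralBinom, centralBinom_eq_halfRatio, centralBinom_eq_halfRatio,
      show (64 : ℝ) ^ (k + m) = (4 ^ k) ^ 3 * (16 ^ m * 4 ^ m) by
        rw [← mul_pow, pow_add, ← pow_mul, mul_comm k 3, pow_mul]; norm_num]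
    ring
  unfold zudilinA scaledA
  push_cast
  rw [h2, h3, Nat.centralBinom, show (1024 : ℝ) ^ n = 16 ^ n * 64 ^ n by
    rw [← mul_pow]; norm_num]
  ring

theorem cubeConv_nonneg (n : ℕ) : 0 ≤ cubeConv n :=
  sum_nonneg fun k _ => by have := halfRatio_pos k; have := halfRatio_pos (n - k); positivity

theorem cubeConv_le (n : ℕ) : cubeConv n ≤ n + 1 := by
  have h : cubeConv n ≤ ∑ _k ∈ range (n + 1), (1 : ℝ) := sum_le_sum fun k _ =>
    mul_le_one₀ (pow_le_one₀ (halfRatio_pos k).le (halfRatio_le_one k)) (halfRatio_pos _).le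
      (halfRatio_le_one _)
  simpa using h

theorem scaledA_nonneg (n : ℕ) : 0 ≤ scaledA n := by
  have := halfRatio_pos (2 * n)
  have := cubeConv_nonneg n
  unfold scaledA
  positivity

theorem geomBound_scaledA : GeomBound scaledA 4 := fun n => by
  have h1 := halfRatio_pos (2 * n)
  have h2 := cubeConv_nonneg n
  have h3 := halfRatio_pos n
  rw [abs_of_nonneg (scaledA_nonneg n)]
  unfold scaledA
  rw [centralBinom_eq_halfRatio]
  calc _ ≤ (4 : ℝ) ^ n * 1 * 1 * (n + 1) := by
        gcongr
        exacts [halfRatio_le_one n, halfRatio_le_one _, cubeConv_le n]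
    _ = _ := by ring

/-- `saalCoeff (n + M) n` is a multiple of the Taylor coefficient `(2n+1/2)_M / M!` of
`(1-X)^{-2n-1/2}`. -/
theorem saalCoeff_add (n M : ℕ) : saalCoeff (n + M) n =
    (n.centralBinom : ℝ) * halfRatio (2 * n) * Ring.choose ((2 * n + 1 / 2 : ℝ) + M - 1) M := by
  rw [← Ring.multichoose_eq]
  induction M with
  | zero =>
    simp only [saalCoeff, add_zero, Nat.choose_self, Ring.multichoose_zero_right, ← two_mul,
      Nat.centralBinom]
    push_cast
    ring
  | succ M ih =>
    have h1 : Ring.multichoose (2 * n + 1 / 2 : ℝ) (M + 1) * (M + 1) =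
        Ring.multichoose (2 * n + 1 / 2 : ℝ) M * (2 * n + 1 / 2 + M) := by
      have ha := Ring.factorial_nsmul_multichoose_eq_ascPochhammer (2 * n + 1 / 2 : ℝ) (M + 1)
      have hb := Ring.factorial_nsmul_multichoose_eq_ascPochhammer (2 * n + 1 / 2 : ℝ) M
      rw [Polynomial.ascPochhammer_smeval_eq_eval, nsmul_eq_mul] at ha hb
      rw [ascPochhammer_succ_eval, ← hb, Nat.factorial_succ] at ha
      push_cast at ha
      have hf : (M.factorial : ℝ) ≠ 0 := by positivity
      refine mul_left_cancel₀ hf ?_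
      linear_combination ha
    have h2 : saalCoeff (n + (M + 1)) n * (M + 1) = saalCoeff (n + M) n * (2 * n + 1 / 2 + M) := by
      have c1 := Nat.choose_mul_succ_eq (n + M + n) n
      have c2 := Nat.choose_mul_succ_eq (n + M) n
      rw [show n + M + n + 1 - n = n + M + 1 by omega] at c1
      rw [show n + M + 1 - n = M + 1 by omega] at c2
      have d1 : ((n + M + n).choose n : ℝ) * (n + M + n + 1) =
        (n + M + n + 1).choose n * (n + M + 1) := by exact_mod_cast c1
      have d2 : ((n + M).choose n : ℝ) * (n + M + 1) =
        (n + M + 1).choose n * (M + 1) := by exact_mod_cast c2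
      unfold saalCoeff
      rw [show n + (M + 1) + n = n + M + n + 1 by ring, ← add_assoc, halfRatio_succ,
        mul_assoc, mul_assoc, ← d2]
      push_cast
      have e : ((n + M + n + 1).choose n : ℝ) = (n + M + n).choose n * (n + M + n + 1) /
        (n + M + 1) := by rw [d1]; field_simp
      rw [e]
      field_simp
      ring
    have hM : (M + 1 : ℝ) ≠ 0 := by positivity
    refine mul_right_cancel₀ hM ?_
    rw [h2, ih]
    linear_combination -(n.centralBinom : ℝ) * halfRatio (2 * n) * h1

/-- Summable row sums of absolute values justify regrouping a double series by antidiagonals. -/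
theorem hasSum_antidiagonal_of_abs {T : ℕ × ℕ → ℝ} {S V : ℕ → ℝ}
    (hS : ∀ n, HasSum (fun m => |T (n, m)|) (S n)) (hs : Summable S)
    (hV : ∀ n, HasSum (fun m => T (n, m)) (V n)) :
    HasSum (fun N => ∑ p ∈ antidiagonal N, T p) (∑' n, V n) := by
  have hT : Summable T := by
    refine Summable.of_abs ((summable_prod_of_nonneg fun p => abs_nonneg (T p)).mpr
      ⟨fun n => (hS n).summable, ?_⟩)
    simpa only [(hS _).tsum_eq] using hs
  have h1 := (hT.hasSum.prod_fiberwise hV).tsum_eq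
  have h2 := (HasAntidiagonal.sigmaAntidiagonalEquivProd (A := ℕ)).hasSum_iff.mpr hT.hasSum
  rw [h1]
  refine (h2.sigma fun N => hasSum_fintype _).congr_fun ?_
  intro N
  exact (sum_coe_sort (antidiagonal N) T).symm

theorem hasSum_choose_mul_pow (s : ℝ) {x : ℝ} (hx : |x| < 1) :
    HasSum (fun M : ℕ => Ring.choose (s + M - 1) M * x ^ M) (1 / (1 - x) ^ s) := by
  have h := (Real.one_div_one_sub_rpow_hasFPowerSeriesOnBall_zero s).hasSum (y := x)
    (by simpa [enorm_eq_nnnorm] using! hx)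
  simpa [FormalMultilinearSeries.ofScalars_apply_eq, mul_comm] using h

theorem hasSum_saalCoeff (n : ℕ) {x : ℝ} (hx : |x| < 1) :
    HasSum (fun M : ℕ => cubeConv n * saalCoeff (n + M) n * x ^ (n + M))
      (scaledA n * (x / (1 - x) ^ 2) ^ n / Real.sqrt (1 - x)) := by
  have h := (hasSum_choose_mul_pow (2 * n + 1 / 2) hx).mul_left (scaledA n * x ^ n)
  have h1x : 0 < 1 - x := by linarith [(abs_lt.mp hx).2]
  have hr : (1 - x) ^ (2 * n + 1 / 2 : ℝ) = ((1 - x) ^ 2) ^ n * Real.sqrt (1 - x) := by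
    rw [Real.rpow_add h1x, ← Real.sqrt_eq_rpow, ← pow_mul, ← Real.rpow_natCast]
    push_cast
    rfl
  rw [hr] at h
  convert! h using 1
  · funext M
    rw [saalCoeff_add, pow_add, scaledA]
    ring
  · rw [div_pow]
    field_simp

theorem hasSum_eulerSeries_zero {c : ℕ → ℝ} {r : ℝ} (hc : GeomBound c r) (hr : 0 < r) {x : ℝ}
    (hx : |x| < 1 / r) : HasSum (fun n => c n * x ^ n) (eulerSeries c 0 x) := by
  simpa [eulerSeries] using (hc.summable hr 0 hx).hasSum

/-- The rearrangement needs |x|/(1-|x|)² < 1/4. This fails at x = -1/4, where the value is 4/9, so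
the identity is proved near 0 and then continued analytically. -/
theorem eulerSeries_halfRatio_of_abs_lt {x : ℝ} (hx : |x| < 1 / 100) :
    eulerSeries (fun n => halfRatio n ^ 5) 0 x =
      eulerSeries scaledA 0 (-x / (1 - x) ^ 2) / Real.sqrt (1 - x) := by
  have hx1 : |x| < 1 := by linarith
  have hq (n : ℕ) := (hasSum_saalCoeff n hx1).mul_left ((-1) ^ n)
  have ha (n : ℕ) := hasSum_saalCoeff n (x := |x|) (by rwa [abs_abs])
  have h := hasSum_antidiagonal_of_abs
    (T := fun p => (-1) ^ p.1 * (cubeConv p.1 * saalCoeff (p.1 + p.2) p.1 * x ^ (p.1 + p.2)))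
    (fun n => by
      convert! ha n using 1
      funext M
      have h1 : 0 ≤ saalCoeff (n + M) n := by
        have := halfRatio_pos (n + M + n)
        unfold saalCoeff
        positivity
      rw [abs_mul, abs_mul, abs_mul, abs_pow, abs_neg, abs_one, one_pow, one_mul, abs_pow,
        abs_of_nonneg h1, abs_of_nonneg (cubeConv_nonneg n)])
    (by
      have h4 : |(|x| / (1 - |x|) ^ 2)| < 1 / 4 := by
        have h2 : 0 < 1 - |x| := by linarith
        rw [abs_of_nonneg (by positivity), div_lt_iff₀ (by positivity)]
        nlinarith [abs_nonneg x]
      exact (hasSum_eulerSeries_zero geomBound_scaledA (by norm_num) h4).summable.div_const _) hq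
  have h5 := hasSum_eulerSeries_zero geomBound_halfRatio_pow one_pos (x := x) (by simpa using hx1)
  have h6 : |-x / (1 - x) ^ 2| < 1 / 4 := by
    have h2 : 99 / 100 < 1 - x := by linarith [(abs_lt.mp hx).2]
    rw [abs_div, abs_neg, abs_of_pos (by positivity : 0 < (1 - x) ^ 2),
      div_lt_iff₀ (by positivity)]
    nlinarith
  have h7 := (hasSum_eulerSeries_zero geomBound_scaledA (by norm_num) h6).div_const
    (Real.sqrt (1 - x))
  rw [← h7.tsum_eq]
  have h8 : (fun N => ∑ p ∈ antidiagonal N, (-1) ^ p.1 *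
      (cubeConv p.1 * saalCoeff (p.1 + p.2) p.1 * x ^ (p.1 + p.2))) =
      fun N => halfRatio N ^ 5 * x ^ N := by
    funext N
    rw [halfRatio_pow_five, Nat.sum_antidiagonal_eq_sum_range_succ_mk, sum_mul]
    refine sum_congr rfl fun n hn => ?_
    have hnN : n + (N - n) = N := Nat.add_sub_cancel' (by simpa [Nat.lt_succ_iff] using hn)
    simp only [hnN]
    ring
  rw [h8] at h
  rw [h5.unique h]
  refine tsum_congr fun n => ?_
  rw [neg_div, neg_eq_neg_one_mul (x / _), mul_pow]
  ring

theorem GeomBound.analyticAt {c : ℕ → ℝ} {r : ℝ} (hc : GeomBound c r) (hr : 0 < r) {x : ℝ}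
    (hx : |x| < 1 / r) : AnalyticAt ℝ (eulerSeries c 0) x := by
  set p := FormalMultilinearSeries.ofScalars ℝ c with hp
  have hrad : ENNReal.ofReal (1 / r) ≤ p.radius := by
    refine ENNReal.le_of_forall_nnreal_lt fun ρ hρ => ?_
    have hρ' : |(ρ : ℝ)| < 1 / r := by
      rw [abs_of_nonneg ρ.coe_nonneg]
      rw [← ENNReal.ofReal_coe_nnreal] at hρ
      exact (ENNReal.ofReal_lt_ofReal_iff (by positivity)).mp hρ
    refine p.le_radius_of_summable_norm ?_
    have := (hc.summable hr 0 hρ').abs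
    refine this.congr fun n => ?_
    rw [hp, FormalMultilinearSeries.ofScalars_norm]
    simp [abs_mul]
  have hpos : 0 < p.radius := lt_of_lt_of_le (by simpa using hr) hrad
  have hf := p.hasFPowerSeriesOnBall hpos
  have he : p.sum = eulerSeries c 0 := by
    funext y
    simp [FormalMultilinearSeries.sum, eulerSeries, hp, mul_comm]
  rw [he] at hf
  refine hf.analyticAt_of_mem ?_
  have : ENNReal.ofReal |x| < ENNReal.ofReal (1 / r) :=
    (ENNReal.ofReal_lt_ofReal_iff (by positivity)).mpr hx
  have h3 := this.trans_le hrad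
  simpa [← ofReal_norm, Real.norm_eq_abs] using h3

/-- On the negative side the bound amounts to (1+x)² > 0; 1/10 is a convenient number below 3 - 2√2,
where the other side fails. -/
theorem abs_neg_div_one_sub_sq_lt {x : ℝ} (h1 : -1 < x) (h2 : x < 1 / 10) :
    |-x / (1 - x) ^ 2| < 1 / 4 := by
  have h3 : 0 < 1 - x := by linarith
  rw [abs_lt, lt_div_iff₀ (by positivity), div_lt_iff₀ (by positivity)]
  constructor <;> nlinarith [mul_pos (by linarith : 0 < x + 1) (by linarith : 0 < x + 1)]

/-- A quadratic transformation between `∑ ((1/2)_n / n!)⁵ xⁿ` and the generating function of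
`zudilinA`. -/
theorem eulerSeries_halfRatio_eq {x : ℝ} (h1 : -1 < x) (h2 : x < 1 / 10) :
    eulerSeries (fun n => halfRatio n ^ 5) 0 x =
      eulerSeries scaledA 0 (-x / (1 - x) ^ 2) / Real.sqrt (1 - x) := by
  have hU : AnalyticOnNhd ℝ (eulerSeries (fun n => halfRatio n ^ 5) 0) (Set.Ioo (-1) (1 / 10)) :=
    fun y hy => geomBound_halfRatio_pow.analyticAt one_pos
      (by rw [abs_lt]; constructor <;> linarith [hy.1, hy.2])
  have hV : AnalyticOnNhd ℝ (fun y => eulerSeries scaledA 0 (-y / (1 - y) ^ 2) / Real.sqrt (1 - y))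
      (Set.Ioo (-1) (1 / 10)) := fun y hy => by
    have hy1 : 0 < 1 - y := by linarith [hy.2]
    have hA := geomBound_scaledA.analyticAt (by norm_num) (abs_neg_div_one_sub_sq_lt hy.1 hy.2)
    have hw : AnalyticAt ℝ (fun y : ℝ => -y / (1 - y) ^ 2) y :=
      (analyticAt_id.neg).div ((analyticAt_const.sub analyticAt_id).pow 2) (by positivity)
    have hs : AnalyticAt ℝ (fun y : ℝ => Real.sqrt (1 - y)) y := by
      have hc : ContDiffAt ℝ ⊤ (fun y : ℝ => Real.sqrt (1 - y)) y :=
        (contDiffAt_const.sub contDiffAt_id).sqrt hy1.ne'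
      exact hc.analyticAt
    exact (AnalyticAt.fun_comp_of_eq hA hw rfl).div hs (Real.sqrt_pos.mpr hy1).ne'
  refine hU.eqOn_of_preconnected_of_eventuallyEq hV isPreconnected_Ioo
    (z₀ := 0) (by norm_num) ?_ ⟨h1, h2⟩
  filter_upwards [Metric.ball_mem_nhds (0 : ℝ) (by norm_num : (0 : ℝ) < 1 / 100)] with y hy
  exact eulerSeries_halfRatio_of_abs_lt (by simpa using hy)

/-! ### The Euler operator applied to the quadratic transformation. -/

theorem GeomBound.hasDerivAt {c : ℕ → ℝ} {r : ℝ} (hc : GeomBound c r) (hr : 0 < r) (i : ℕ) {x : ℝ}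
    (hx : |x| < 1 / r) (hx0 : x ≠ 0) :
    HasDerivAt (eulerSeries c i) (eulerSeries c (i + 1) x / x) x := by
  -- Termwise differentiation needs a uniform majorant near x, supplied by an intermediate radius ρ.
  obtain ⟨ρ, hxρ, hρr⟩ := exists_between hx
  have hρ : 0 < ρ := (abs_nonneg x).trans_lt hxρ
  have hu := ((hc.summable hr (i + 1) (x := ρ) (by rwa [abs_of_pos hρ])).abs).div_const ρ
  have hmem : x ∈ Set.Ioo (-ρ) ρ := abs_lt.mp hxρ
  have h := hasDerivAt_tsum_of_isPreconnected hu isOpen_Ioo isPreconnected_Ioo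
    (g := fun (n : ℕ) y => (n : ℝ) ^ i * c n * y ^ n)
    (g' := fun (n : ℕ) y => (n : ℝ) ^ i * c n * (n * y ^ (n - 1)))
    (fun (n : ℕ) y _ => (hasDerivAt_pow n y).const_mul _)
    (fun (n : ℕ) y hy => by
      have hy' : |y| < ρ := abs_lt.mpr hy
      cases n with
      | zero => simp
      | succ n =>
        rw [Nat.add_sub_cancel, Real.norm_eq_abs, le_div_iff₀ hρ]
        simp only [abs_mul, abs_pow, Nat.abs_cast, abs_of_pos hρ]
        calc _ = ((n + 1 : ℕ) : ℝ) ^ (i + 1) * |c (n + 1)| * (|y| ^ n * ρ) := by ring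
          _ ≤ ((n + 1 : ℕ) : ℝ) ^ (i + 1) * |c (n + 1)| * (ρ ^ n * ρ) := by gcongr
          _ = _ := by ring)
    hmem (hc.summable hr i hx) hmem
  convert! h using 1
  unfold eulerSeries
  rw [← tsum_div_const]
  refine tsum_congr fun n => ?_
  cases n with
  | zero => simp
  | succ n =>
    rw [Nat.add_sub_cancel]
    field_simp
    ring

/-- Apply θ = x d/dx to the transformation; for w = -x/(1-x)² one has θw/w = (1+x)/(1-x). Taking x <
0 keeps w nonzero. -/
theorem eulerSeries_halfRatio_one_eq {x : ℝ} (h1 : -1 < x) (h2 : x < 0) :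
    eulerSeries (fun n => halfRatio n ^ 5) 1 x =
      (x / (2 * (1 - x)) * eulerSeries scaledA 0 (-x / (1 - x) ^ 2) +
        (1 + x) / (1 - x) * eulerSeries scaledA 1 (-x / (1 - x) ^ 2)) / Real.sqrt (1 - x) := by
  have hx : 0 < 1 - x := by linarith
  have hsq := Real.sq_sqrt hx.le
  have hs := Real.sqrt_pos.mpr hx
  have hlt := abs_neg_div_one_sub_sq_lt h1 (by linarith : x < 1 / 10)
  have hw0 : -x / (1 - x) ^ 2 ≠ 0 := (div_pos (by linarith) (by positivity)).ne'
  have hsub : HasDerivAt (fun y : ℝ => 1 - y) (-1) x := by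
    simpa using (hasDerivAt_id x).const_sub 1
  have hw : HasDerivAt (fun y : ℝ => -y / (1 - y) ^ 2) (-(1 + x) / (1 - x) ^ 3) x := by
    convert! ((hasDerivAt_id x).neg).div (hsub.pow 2) (pow_pos hx 2).ne' using 1
    simp only [id, Pi.pow_apply, Pi.neg_apply]
    field_simp
    ring
  have hq : HasDerivAt (fun y : ℝ => Real.sqrt (1 - y)) (-1 / (2 * Real.sqrt (1 - x))) x :=
    hsub.sqrt hx.ne'
  have hA0 := (geomBound_scaledA.hasDerivAt (by norm_num) 0 hlt hw0).comp x hw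
  have hR := hA0.div hq hs.ne'
  have hU := geomBound_halfRatio_pow.hasDerivAt one_pos 0 (x := x)
    (by rw [abs_lt]; constructor <;> linarith) h2.ne
  have hE := hU.congr_of_eventuallyEq (f₁ := fun y =>
    eulerSeries scaledA 0 (-y / (1 - y) ^ 2) / Real.sqrt (1 - y)) (by
      filter_upwards [isOpen_Ioo.mem_nhds (⟨h1, h2⟩ : x ∈ Set.Ioo (-1) 0)] with y hy
      exact (eulerSeries_halfRatio_eq hy.1 (by linarith [hy.2])).symm)
  have h := hE.unique hR
  rw [div_eq_iff h2.ne] at h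
  rw [zero_add] at h
  rw [h, hsq]
  simp only [Function.comp_apply]
  have hx0 := h2.ne
  field_simp
  rw [hsq]
  ring

theorem eulerSeries_halfRatio_two_eq {x : ℝ} (h1 : -1 < x) (h2 : x < 0) :
    eulerSeries (fun n => halfRatio n ^ 5) 2 x =
      (x * (2 + x) / (4 * (1 - x) ^ 2) * eulerSeries scaledA 0 (-x / (1 - x) ^ 2) +
        x * (3 + x) / (1 - x) ^ 2 * eulerSeries scaledA 1 (-x / (1 - x) ^ 2) +
        (1 + x) ^ 2 / (1 - x) ^ 2 * eulerSeries scaledA 2 (-x / (1 - x) ^ 2)) /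
          Real.sqrt (1 - x) := by
  have hx : 0 < 1 - x := by linarith
  have hsq := Real.sq_sqrt hx.le
  have hs := Real.sqrt_pos.mpr hx
  have hlt := abs_neg_div_one_sub_sq_lt h1 (by linarith : x < 1 / 10)
  have hw0 : -x / (1 - x) ^ 2 ≠ 0 := (div_pos (by linarith) (by positivity)).ne'
  have hsub : HasDerivAt (fun y : ℝ => 1 - y) (-1) x := by
    simpa using (hasDerivAt_id x).const_sub 1
  have hw : HasDerivAt (fun y : ℝ => -y / (1 - y) ^ 2) (-(1 + x) / (1 - x) ^ 3) x := by
    convert! ((hasDerivAt_id x).neg).div (hsub.pow 2) (pow_pos hx 2).ne' using 1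
    simp only [id, Pi.pow_apply, Pi.neg_apply]
    field_simp
    ring
  have hq : HasDerivAt (fun y : ℝ => Real.sqrt (1 - y)) (-1 / (2 * Real.sqrt (1 - x))) x :=
    hsub.sqrt hx.ne'
  have hA0 := (geomBound_scaledA.hasDerivAt (by norm_num) 0 hlt hw0).comp x hw
  have hA1 := (geomBound_scaledA.hasDerivAt (by norm_num) 1 hlt hw0).comp x hw
  have hr0 : HasDerivAt (fun y : ℝ => y / (2 * (1 - y))) (1 / (2 * (1 - x) ^ 2)) x := by
    convert! (hasDerivAt_id x).div (hsub.const_mul 2) (by positivity) using 1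
    simp only [id]
    field_simp
    ring
  have hr1 : HasDerivAt (fun y : ℝ => (1 + y) / (1 - y)) (2 / (1 - x) ^ 2) x := by
    convert! ((hasDerivAt_id x).const_add 1).div hsub hx.ne' using 1
    simp only [id]
    field_simp
    ring
  have hR := ((hr0.mul hA0).add (hr1.mul hA1)).div hq hs.ne'
  have hU := geomBound_halfRatio_pow.hasDerivAt one_pos 1 (x := x)
    (by rw [abs_lt]; constructor <;> linarith) h2.ne
  have hE := hU.congr_of_eventuallyEq (f₁ := fun y =>
    (y / (2 * (1 - y)) * eulerSeries scaledA 0 (-y / (1 - y) ^ 2) +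
      (1 + y) / (1 - y) * eulerSeries scaledA 1 (-y / (1 - y) ^ 2)) / Real.sqrt (1 - y)) (by
      filter_upwards [isOpen_Ioo.mem_nhds (⟨h1, h2⟩ : x ∈ Set.Ioo (-1) 0)] with y hy
      exact (eulerSeries_halfRatio_one_eq hy.1 hy.2).symm)
  have h := hE.unique hR
  rw [div_eq_iff h2.ne] at h
  norm_num only at h
  rw [h, hsq]
  simp only [Function.comp_apply, Pi.add_apply, Pi.mul_apply]
  have hx0 := h2.ne
  field_simp
  rw [hsq]
  ring

/-! ### The binomial transform and its generating function. -/

theorem geomBound_zudilinB : GeomBound (fun n => (zudilinB n : ℝ)) 4097 := fun n => by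
  unfold zudilinB binomialTransform
  push_cast
  refine (abs_sum_le_sum_abs _ _).trans ?_
  -- |a_j| ≤ (j+1)·4096^j, and the binomial theorem then gives the ratio 4096 + 1.
  calc _ ≤ ∑ j ∈ range (n + 1), ((n : ℝ) + 1) * ((4096 : ℝ) ^ j * 1 ^ (n - j) * n.choose j) := by
        refine sum_le_sum fun j hj => ?_
        have hjn : (j : ℝ) ≤ n := by
          exact_mod_cast (by simpa [Nat.lt_succ_iff] using hj : j ≤ n)
        have h := geomBound_scaledA j
        rw [abs_of_nonneg (scaledA_nonneg j)] at h
        rw [zudilinA_eq, abs_mul, abs_mul, abs_pow, abs_neg, abs_one, one_pow, one_mul,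
          Nat.abs_cast, abs_of_nonneg (mul_nonneg (by positivity) (scaledA_nonneg j)), one_pow,
          mul_one]
        calc _ ≤ (n.choose j : ℝ) * (1024 ^ j * ((n + 1) * 4 ^ j)) := by
              gcongr
              exact h.trans (by gcongr)
          _ = _ := by
              rw [show (4096 : ℝ) ^ j = 1024 ^ j * 4 ^ j by rw [← mul_pow]; norm_num]
              ring
    _ = _ := by
        rw [← mul_sum, ← add_pow]
        norm_num

theorem abs_mul_div_one_sub_lt {z : ℝ} (hz : |z| < 1 / 4097) : |-1024 * z / (1 - z)| < 1 / 4 := by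
  have := abs_lt.mp hz
  have h1z : 0 < 1 - z := by linarith
  rw [abs_lt, lt_div_iff₀ h1z, div_lt_iff₀ h1z]
  constructor <;> linarith

/-- The generating function of the binomial transform. -/
theorem eulerSeries_zudilinB_eq {z : ℝ} (hz : |z| < 1 / 4097) :
    eulerSeries (fun n => (zudilinB n : ℝ)) 0 z =
      eulerSeries scaledA 0 (-1024 * z / (1 - z)) / (1 - z) := by
  have hz1 : |z| < 1 := by linarith
  have h1z : 0 < 1 - z := by linarith [(abs_lt.mp hz1).2]
  have h1a : 0 < 1 - |z| := by linarith
  have key (j : ℕ) (y : ℝ) := hasSum_choose_mul_geometric_of_norm_lt_one (𝕜 := ℝ) j (r := y)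
  have h := hasSum_antidiagonal_of_abs
    (T := fun p => ((-1) ^ p.1 * zudilinA p.1 * z ^ p.1) * (((p.2 + p.1).choose p.1 : ℝ) * z ^ p.2))
    (fun j => by
      convert! (key j |z| (by simpa using hz1)).mul_left (zudilinA j * |z| ^ j) using 1
      funext M
      rw [abs_mul, abs_mul, abs_mul, abs_mul, abs_pow, abs_pow, abs_pow, abs_neg, abs_one, one_pow,
        one_mul, Nat.abs_cast, zudilinA_eq,
        abs_of_nonneg (mul_nonneg (by positivity) (scaledA_nonneg j))])
    (by
      have h4 : |(1024 * |z| / (1 - |z|))| < 1 / 4 := by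
        rw [abs_of_nonneg (by positivity), div_lt_iff₀ h1a]
        linarith
      refine ((hasSum_eulerSeries_zero geomBound_scaledA (by norm_num) h4).summable.div_const
        (1 - |z|)).congr fun j => ?_
      rw [zudilinA_eq, div_pow, mul_pow, pow_succ]
      field_simp)
    (fun j => (key j z (by simpa using hz1)).mul_left ((-1) ^ j * zudilinA j * z ^ j))
  have h5 := hasSum_eulerSeries_zero geomBound_zudilinB (by norm_num) hz
  have h6 := abs_mul_div_one_sub_lt hz
  have h7 := (hasSum_eulerSeries_zero geomBound_scaledA (by norm_num) h6).div_const (1 - z)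
  rw [← h7.tsum_eq]
  have h8 : (fun N => ∑ p ∈ antidiagonal N, ((-1) ^ p.1 * (zudilinA p.1 : ℝ) * z ^ p.1) *
      (((p.2 + p.1).choose p.1 : ℝ) * z ^ p.2)) = fun N => (zudilinB N : ℝ) * z ^ N := by
    funext N
    unfold zudilinB binomialTransform
    push_cast
    rw [Nat.sum_antidiagonal_eq_sum_range_succ_mk, sum_mul]
    refine sum_congr rfl fun n hn => ?_
    have hnN : N - n + n = N := Nat.sub_add_cancel (by simpa [Nat.lt_succ_iff] using hn)
    have hp : z ^ N = z ^ (N - n) * z ^ n := by rw [← pow_add, hnN]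
    simp only [hnN]
    rw [hp]
    ring
  rw [h8] at h
  rw [h5.unique h]
  refine tsum_congr fun n => ?_
  rw [zudilinA_eq, div_pow, mul_pow, show (-1024 : ℝ) = -1 * 1024 by norm_num, mul_pow, pow_succ]
  field_simp

theorem hasDerivAt_mul_div_one_sub {z : ℝ} (hz : 0 < 1 - z) :
    HasDerivAt (fun y : ℝ => -1024 * y / (1 - y)) (-1024 / (1 - z) ^ 2) z := by
  have hsub : HasDerivAt (fun y : ℝ => 1 - y) (-1) z := by
    simpa using (hasDerivAt_id z).const_sub 1
  convert! ((hasDerivAt_id z).const_mul (-1024)).div hsub hz.ne' using 1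
  simp only [id]
  field_simp
  ring

/-- Again the Euler operator: for w = -1024z/(1-z) one has θw/w = 1/(1-z). -/
theorem eulerSeries_zudilinB_one_eq {z : ℝ} (hz : |z| < 1 / 4097) (hz0 : z ≠ 0) :
    eulerSeries (fun n => (zudilinB n : ℝ)) 1 z =
      (z * eulerSeries scaledA 0 (-1024 * z / (1 - z)) +
        eulerSeries scaledA 1 (-1024 * z / (1 - z))) / (1 - z) ^ 2 := by
  have h1z : 0 < 1 - z := by linarith [(abs_lt.mp hz).2]
  have hlt := abs_mul_div_one_sub_lt hz
  have hw0 : -1024 * z / (1 - z) ≠ 0 := div_ne_zero (mul_ne_zero (by norm_num) hz0) h1z.ne'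
  have hsub : HasDerivAt (fun y : ℝ => 1 - y) (-1) z := by
    simpa using (hasDerivAt_id z).const_sub 1
  have hw := hasDerivAt_mul_div_one_sub h1z
  have hR := ((geomBound_scaledA.hasDerivAt (by norm_num) 0 hlt hw0).comp z hw).div hsub h1z.ne'
  have hE := (geomBound_zudilinB.hasDerivAt (by norm_num) 0 hz hz0).congr_of_eventuallyEq
    (f₁ := fun y => eulerSeries scaledA 0 (-1024 * y / (1 - y)) / (1 - y)) (by
      filter_upwards [(isOpen_lt continuous_abs continuous_const).mem_nhds hz] with y hy
      exact (eulerSeries_zudilinB_eq hy).symm)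
  have h := hE.unique hR
  rw [div_eq_iff hz0, zero_add] at h
  rw [h]
  simp only [Function.comp_apply]
  field_simp
  ring

theorem eulerSeries_zudilinB_two_eq {z : ℝ} (hz : |z| < 1 / 4097) (hz0 : z ≠ 0) :
    eulerSeries (fun n => (zudilinB n : ℝ)) 2 z =
      (z * (1 + z) * eulerSeries scaledA 0 (-1024 * z / (1 - z)) +
        3 * z * eulerSeries scaledA 1 (-1024 * z / (1 - z)) +
        eulerSeries scaledA 2 (-1024 * z / (1 - z))) / (1 - z) ^ 3 := by
  have h1z : 0 < 1 - z := by linarith [(abs_lt.mp hz).2]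
  have hlt := abs_mul_div_one_sub_lt hz
  have hw0 : -1024 * z / (1 - z) ≠ 0 := div_ne_zero (mul_ne_zero (by norm_num) hz0) h1z.ne'
  have hsub : HasDerivAt (fun y : ℝ => 1 - y) (-1) z := by
    simpa using (hasDerivAt_id z).const_sub 1
  have hw := hasDerivAt_mul_div_one_sub h1z
  have hR := ((((hasDerivAt_id z).mul
    ((geomBound_scaledA.hasDerivAt (by norm_num) 0 hlt hw0).comp z hw)).add
    ((geomBound_scaledA.hasDerivAt (by norm_num) 1 hlt hw0).comp z hw))).div (hsub.pow 2)
      (by simpa using h1z.ne')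
  have hE := (geomBound_zudilinB.hasDerivAt (by norm_num) 1 hz hz0).congr_of_eventuallyEq
    (f₁ := fun y => (y * eulerSeries scaledA 0 (-1024 * y / (1 - y)) +
        eulerSeries scaledA 1 (-1024 * y / (1 - y))) / (1 - y) ^ 2) (by
      filter_upwards [(isOpen_lt continuous_abs continuous_const).mem_nhds hz,
        isOpen_ne.mem_nhds hz0] with y hy hy0
      exact (eulerSeries_zudilinB_one_eq hy hy0).symm)
  have h := hE.unique hR
  rw [div_eq_iff hz0] at h
  norm_num only at h
  rw [h]
  simp only [Function.comp_apply, Pi.add_apply, Pi.mul_apply, Pi.pow_apply, id]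
  field_simp
  ring

/-! ### Specialization at the two points. -/

theorem mainTheorem7 :
    HasSum
      (fun n : ℕ => (-1 : ℝ) ^ n * (zudilinB n : ℝ) *
        (3276800 * (n : ℝ) ^ 2 - 1818624 * (n : ℝ) - 545735) * (1 / (6399 : ℝ) ^ n))
      ((3 : ℝ) ^ 10 * 79 ^ 3 * Real.sqrt 5 / (2 ^ 7 * 5 ^ 3 * Real.pi ^ 2)) ∧
    HasSum
      (fun n : ℕ => (-1 : ℝ) ^ n * (zudilinB n : ℝ) *
        (76354828515625 * (n : ℝ) ^ 2 + 16569725866875 * (n : ℝ) + 1169782053458) *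
          (1 / (1050624 : ℝ) ^ n))
      ((2 : ℝ) ^ 33 * 3 ^ 7 * 19 ^ 3 * Real.sqrt 41 / (41 ^ 3 * Real.pi ^ 2)) := by
  have hpi := Real.pi_pos
  constructor
  · have hz : |(-1 / 6399 : ℝ)| < 1 / 4097 := by norm_num [abs_div]
    have h := geomBound_zudilinB.hasSum_quadratic (by norm_num) hz 3276800 (-1818624) (-545735)
    have hG := guillera_quarter
    have hsqrt : Real.sqrt (1 - -1 / 4) = Real.sqrt 5 / 2 := by
      rw [show (1 - -1 / 4 : ℝ) = 5 / 2 ^ 2 by norm_num, Real.sqrt_div (by norm_num),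
        Real.sqrt_sq (by norm_num)]
    rw [eulerSeries_halfRatio_eq (by norm_num) (by norm_num),
      eulerSeries_halfRatio_one_eq (by norm_num) (by norm_num),
      eulerSeries_halfRatio_two_eq (by norm_num) (by norm_num), hsqrt] at hG
    rw [eulerSeries_zudilinB_eq hz, eulerSeries_zudilinB_one_eq hz (by norm_num),
      eulerSeries_zudilinB_two_eq hz (by norm_num)] at h
    norm_num only at hG h
    generalize eulerSeries scaledA 0 (4 / 25) = A0 at hG h
    generalize eulerSeries scaledA 1 (4 / 25) = A1 at hG h
    generalize eulerSeries scaledA 2 (4 / 25) = A2 at hG h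
    have h5 : Real.sqrt 5 ≠ 0 := by positivity
    -- Guillera's identity transported to w = 4/25 and multiplied by √(1-x) = √5/2.
    have hA : 36 / 5 * A2 - 4 * A1 - 6 / 5 * A0 = 4 * Real.sqrt 5 / Real.pi ^ 2 := by
      calc _ = (8 / Real.pi ^ 2) * (Real.sqrt 5 / 2) := by
            rw [← hG]
            field_simp
            ring
        _ = _ := by ring
    convert! h using 1
    · funext n
      rw [show (-(1 / 6399) : ℝ) = -1 / 6399 by norm_num, div_pow]
      ring
    -- The factor is the ratio of the two linear forms, read off from the `A2` coefficients
    -- 3276800·(6399/6400)³ and 36/5, with 6399 = 3⁴·79.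
    · calc _ = (3 ^ 10 * 79 ^ 3 / 64000) * (4 * Real.sqrt 5 / Real.pi ^ 2) := by
            field_simp
            ring
        _ = _ := by
            rw [← hA]
            ring
  · have hz : |(-1 / 1050624 : ℝ)| < 1 / 4097 := by norm_num [abs_div]
    have h := geomBound_zudilinB.hasSum_quadratic (by norm_num) hz 76354828515625 16569725866875
      1169782053458
    have hG := guillera_inv_1024
    have hsqrt : Real.sqrt (1 - -1 / 1024) = 5 * Real.sqrt 41 / 32 := by
      rw [show (1 - -1 / 1024 : ℝ) = 5 ^ 2 * 41 / 32 ^ 2 by norm_num, Real.sqrt_div (by norm_num),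
        Real.sqrt_mul (by norm_num), Real.sqrt_sq (by norm_num), Real.sqrt_sq (by norm_num)]
    rw [eulerSeries_halfRatio_eq (by norm_num) (by norm_num),
      eulerSeries_halfRatio_one_eq (by norm_num) (by norm_num),
      eulerSeries_halfRatio_two_eq (by norm_num) (by norm_num), hsqrt] at hG
    rw [eulerSeries_zudilinB_eq hz, eulerSeries_zudilinB_one_eq hz (by norm_num),
      eulerSeries_zudilinB_two_eq hz (by norm_num)] at h
    norm_num only at hG h
    generalize eulerSeries scaledA 0 (1024 / 1050625) = A0 at hG h
    generalize eulerSeries scaledA 1 (1024 / 1050625) = A1 at hG h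
    generalize eulerSeries scaledA 2 (1024 / 1050625) = A2 at hG h
    have h41 : Real.sqrt 41 ≠ 0 := by positivity
    have hA : 4186116 / 5125 * A2 + 908416 / 5125 * A1 + 64128 / 5125 * A0 = 20 * Real.sqrt 41 / Real.pi ^ 2 := by
      calc _ = (128 / Real.pi ^ 2) * (5 * Real.sqrt 41 / 32) := by
            rw [← hG]
            field_simp
            ring
        _ = _ := by ring
    convert! h using 1
    · funext n
      rw [show (-(1 / 1050624) : ℝ) = -1 / 1050624 by norm_num, div_pow]
      ring
    -- The same ratio of `A2` coefficients, with 1050624 = 2¹¹·3³·19 and 1050625 = 5⁴·41².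
    · calc _ = (2 ^ 33 * 3 ^ 7 * 19 ^ 3 / (20 * 41 ^ 3)) * (20 * Real.sqrt 41 / Real.pi ^ 2) := by
            field_simp
        _ = _ := by
            rw [← hA]
            ring
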